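/- Let $\Sigma$ be a smooth $2$-dimensional manifold. A surface in $\mathbb{R}^3$ with unit normal $n$ is a smooth map $x:\Sigma\to\mathbb{R}^3$ together with a smooth map $n:\Sigma\to S^2$ such that $(dx,n)=0$ and the pair $(x,n)$ is an immersion ($x$ itself may have singular points). Its second and third fundamental forms are $I\!I=-(dx,dn)$ and $I\!I\!I=(dn,dn)$. A tangent vector $X\neq 0$ is a curvature direction if $dx(X)$ and $dn(X)$ are linearly dependent, and $p\in\Sigma$ is an umbilic if $dx$ and $dn$ are proportional on $T_p\Sigma$. Two surfaces $x,\hat x:\Sigma\to\mathbb{R}^3$ are Combescure transforms of each other if they have a common unit normal $n$ and parallel curvature directions, i.e., every $T_p\Sigma$ has a basis of vectors $X$ that are curvature directions of both surfaces and for which $dx(X)$ and $d\hat x(X)$ are linearly dependent. Theorem. Let $\hat x:\Sigma\to\mathbb{R}^3$ be an immersed minimal surface with unit normal $n$ and without umbilics. Then any Combescure transform $x:\Sigma\to\mathbb{R}^3$ of $\hat x$ (with common normal $n$) is an $L$-isothermic surface. That is: (a) around every point of $\Sigma$ there are curvature line coordinates $(u,v)$ of $x$ that are conformal with respect to the third fundamental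 form, $I\!I\!I=e^{2w}(du^2+dv^2)$; and (b) there is a real quadratic differential $q$ on $\Sigma$ that is holomorphic with respect to $I\!I\!I$, i.e., around every point there is a complex coordinate $z$ with $I\!I\!I=e^{2w}\,dz\,d\bar z$, $q^{2,0}=q(\partial_z,\partial_z)\,dz^2=dz^2$ and $q^{1,1}=0$, and that commutes with the second fundamental form of $x$: $I\!I^{2,0}=\mu\, q^{2,0}$ for some function $\mu:\Sigma\to\mathbb{R}$, where the bidegrees are taken with respect to the conformal structure of $I\!I\!I$. -/

import Mathlib

open scoped Manifold ContDiff

noncomputable section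

namespace LIsothermic

/-- The Euclidean plane, in which coordinates take their values. -/
abbrev E2 : Type := EuclideanSpace ℝ (Fin 2)

/-- Euclidean 3-space. -/
abbrev E3 : Type := EuclideanSpace ℝ (Fin 3)

/-- Two vectors of `ℝ³` are parallel: they are linearly dependent (either may vanish). -/
def Parallel (v w : E3) : Prop :=
  ∃ a b : ℝ, (a ≠ 0 ∨ b ≠ 0) ∧ a • v + b • w = 0

section Surfaces

variable {M : Type*} [TopologicalSpace M] [ChartedSpace E2 M]

/-- The differential at `p` of an `ℝ³`-valued map on `M`, as a map into `ℝ³`. -/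
def diff (y : M → E3) (p : M) : TangentSpace (𝓡 2) p →L[ℝ] E3 :=
  mfderiv (𝓡 2) 𝓘(ℝ, E3) y p

/-- `x : M → ℝ³` is a smooth surface with smooth unit normal `n`. The surface is allowed to have
singular points, as projections of Legendre maps may: only the pair `(x, n)` has to immerse. -/
structure IsSurfaceWithNormal (x n : M → E3) : Prop where
  smooth : ContMDiff (𝓡 2) 𝓘(ℝ, E3) ∞ x
  smooth_normal : ContMDiff (𝓡 2) 𝓘(ℝ, E3) ∞ n
  norm_normal : ∀ p, ‖n p‖ = 1
  orthogonal : ∀ (p : M) (X : TangentSpace (𝓡 2) p), inner ℝ (diff x p X) (n p) = 0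
  immersive : ∀ (p : M) (X : TangentSpace (𝓡 2) p), diff x p X = 0 → diff n p X = 0 → X = 0

/-- `X` is a curvature direction (Rodrigues): `X ≠ 0` and `dx(X)`, `dn(X)` are parallel. -/
def IsCurvatureDirection (x n : M → E3) (p : M) (X : TangentSpace (𝓡 2) p) : Prop :=
  X ≠ 0 ∧ Parallel (diff x p X) (diff n p X)

/-- `p` is an umbilic: `dx` and `dn` are proportional at `p`. -/
def IsUmbilic (x n : M → E3) (p : M) : Prop :=
  ∃ a b : ℝ, (a ≠ 0 ∨ b ≠ 0) ∧
    ∀ X : TangentSpace (𝓡 2) p, a • diff x p X + b • diff n p X = 0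

/-- `x` is an immersed minimal surface with unit normal `n`: the shape operator `S`, i.e. the
(unique) endomorphism of the tangent plane with `dn = - dx ∘ S`, has trace `0`. -/
structure IsMinimalSurface (x n : M → E3) : Prop where
  surface : IsSurfaceWithNormal x n
  immersion : ∀ p : M, Function.Injective (diff x p)
  trace_shape : ∀ p : M, ∃ S : TangentSpace (𝓡 2) p →ₗ[ℝ] TangentSpace (𝓡 2) p,
    (∀ X, diff n p X = -diff x p (S X)) ∧
      LinearMap.trace ℝ (TangentSpace (𝓡 2) p) S = 0

/-- `x` and `y` are Combescure transforms of each other, with common unit normal `n`: they have the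
same curvature directions, and these are mapped to parallel directions of `ℝ³`. (At an umbilic of
one of the surfaces every direction is a curvature direction of that surface, so common curvature
directions are asked for.) -/
structure IsCombescurePair (n x y : M → E3) : Prop where
  left : IsSurfaceWithNormal x n
  right : IsSurfaceWithNormal y n
  parallel : ∀ p : M, ∃ b : Module.Basis (Fin 2) ℝ (TangentSpace (𝓡 2) p), ∀ i,
    IsCurvatureDirection x n p (b i) ∧ IsCurvatureDirection y n p (b i) ∧
      Parallel (diff x p (b i)) (diff y p (b i))

/-- The second fundamental form `-(dx, dn)`. -/
def secondForm (x n : M → E3) (p : M) (X Y : TangentSpace (𝓡 2) p) : ℝ :=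
  -inner ℝ (diff x p X) (diff n p Y)

/-- The third fundamental form `(dn, dn)`. -/
def thirdForm (n : M → E3) (p : M) (X Y : TangentSpace (𝓡 2) p) : ℝ :=
  inner ℝ (diff n p X) (diff n p Y)

/-- The coordinate vectors `∂/∂u` (`i = 0`) and `∂/∂v` (`i = 1`) of the coordinates `φ = (u, v)`, at
the point with coordinates `z`. -/
def coordVec (φ : OpenPartialHomeomorph M E2) (z : E2) (i : Fin 2) :
    TangentSpace (𝓡 2) (φ.symm z) :=
  mfderiv (𝓡 2) (𝓡 2) φ.symm z (EuclideanSpace.single i (1 : ℝ) : E2)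

/-- The value `B(∂/∂z, ∂/∂z)` of the complex bilinear extension of a real bilinear form `B`, where
`∂/∂z = (∂/∂u - i ∂/∂v) / 2`. This is the coefficient of `dz²` in the `(2,0)`-part of `B`. -/
def coeff20 (φ : OpenPartialHomeomorph M E2) (z : E2)
    (B : TangentSpace (𝓡 2) (φ.symm z) → TangentSpace (𝓡 2) (φ.symm z) → ℝ) : ℂ :=
  (1 / 4 : ℂ) *
    ((B (coordVec φ z 0) (coordVec φ z 0) : ℂ) - (B (coordVec φ z 1) (coordVec φ z 1) : ℂ)
      - Complex.I *
        ((B (coordVec φ z 0) (coordVec φ z 1) : ℂ) + (B (coordVec φ z 1) (coordVec φ z 0) : ℂ)))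

/-- The value `B(∂/∂z, ∂/∂z̄)` of the complex bilinear extension of a real bilinear form `B`. -/
def coeff11 (φ : OpenPartialHomeomorph M E2) (z : E2)
    (B : TangentSpace (𝓡 2) (φ.symm z) → TangentSpace (𝓡 2) (φ.symm z) → ℝ) : ℂ :=
  (1 / 4 : ℂ) *
    ((B (coordVec φ z 0) (coordVec φ z 0) : ℂ) + (B (coordVec φ z 1) (coordVec φ z 1) : ℂ)
      + Complex.I *
        ((B (coordVec φ z 0) (coordVec φ z 1) : ℂ) - (B (coordVec φ z 1) (coordVec φ z 0) : ℂ)))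

/-- `φ = (u, v)` are smooth coordinates on an open subset of `M` that are conformal with respect to
the third fundamental form: `III = e^{2w} (du² + dv²)`. -/
def IsConformalChart (n : M → E3) (φ : OpenPartialHomeomorph M E2) : Prop :=
  φ ∈ IsManifold.maximalAtlas (𝓡 2) ∞ M ∧
    ∃ w : E2 → ℝ, ∀ z ∈ φ.target, ∀ i j : Fin 2,
      thirdForm n (φ.symm z) (coordVec φ z i) (coordVec φ z j) =
        if i = j then Real.exp (2 * w z) else 0

/-- Around every point there are curvature line coordinates of the surface `x` that are conformal
with respect to its third fundamental form. -/
def HasConformalCurvatureLineCoords (x n : M → E3) : Prop :=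
  ∀ p : M, ∃ φ : OpenPartialHomeomorph M E2, p ∈ φ.source ∧ IsConformalChart n φ ∧
    ∀ z ∈ φ.target, ∀ i : Fin 2, IsCurvatureDirection x n (φ.symm z) (coordVec φ z i)

/-- A (real) quadratic differential `q` on all of `M` is holomorphic with respect to the third
fundamental form: around every point there is a complex coordinate `z = u + iv` with
`III = e^{2w} dz dz̄`, `q^{2,0} = dz²` and `q^{1,1} = 0`. -/
def IsHolomorphicQuadDiff (n : M → E3)
    (q : ∀ p : M, TangentSpace (𝓡 2) p →ₗ[ℝ] TangentSpace (𝓡 2) p →ₗ[ℝ] ℝ) : Prop :=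
  (∀ (p : M) (X Y : TangentSpace (𝓡 2) p), q p X Y = q p Y X) ∧
    ∀ p : M, ∃ φ : OpenPartialHomeomorph M E2, p ∈ φ.source ∧ IsConformalChart n φ ∧
      ∀ z ∈ φ.target,
        coeff20 φ z (fun X Y => q (φ.symm z) X Y) = 1 ∧
          coeff11 φ z (fun X Y => q (φ.symm z) X Y) = 0

/-- `q` commutes with the second fundamental form of `x`: `II^{2,0} = μ q^{2,0}` for a real valued
function `μ`, the bidegrees being those of the conformal structure of the third fundamental form.
(As `μ` is real, the condition does not depend on the orientation of the coordinates.) -/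
def CommutesWithSecondForm (x n : M → E3)
    (q : ∀ p : M, TangentSpace (𝓡 2) p →ₗ[ℝ] TangentSpace (𝓡 2) p →ₗ[ℝ] ℝ) : Prop :=
  ∃ μ : M → ℝ, ∀ φ : OpenPartialHomeomorph M E2, IsConformalChart n φ → ∀ z ∈ φ.target,
    coeff20 φ z (secondForm x n (φ.symm z)) =
      (μ (φ.symm z) : ℂ) * coeff20 φ z (fun X Y => q (φ.symm z) X Y)

/-- The surface `x` with unit normal `n` is L-isothermic: it admits curvature line coordinates that
are conformal with respect to the third fundamental form, and there is, globally on `M`, a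
holomorphic quadratic differential that commutes with the second fundamental form. -/
structure IsLIsothermic (x n : M → E3) : Prop where
  surface : IsSurfaceWithNormal x n
  curvature_line_coords : HasConformalCurvatureLineCoords x n
  quad_diff : ∃ q : ∀ p : M, TangentSpace (𝓡 2) p →ₗ[ℝ] TangentSpace (𝓡 2) p →ₗ[ℝ] ℝ,
    IsHolomorphicQuadDiff n q ∧ CommutesWithSecondForm x n q

end Surfaces

end LIsothermic

end

namespace LIsothermic

section Charts

variable {M : Type*} [TopologicalSpace M] [ChartedSpace E2 M]

lemma contDiffAt_comp_chart_symm [IsManifold (𝓡 2) ∞ M] {y : M → E3}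
    (hy : ContMDiff (𝓡 2) 𝓘(ℝ, E3) ∞ y)
    {φ : OpenPartialHomeomorph M E2} (hφ : φ ∈ IsManifold.maximalAtlas (𝓡 2) ∞ M)
    {z : E2} (hz : z ∈ φ.target) : ContDiffAt ℝ ∞ (y ∘ φ.symm) z := by
  have h := contMDiffAt_symm_of_mem_maximalAtlas hφ hz
  exact ((hy.contMDiffAt (x := φ.symm z)).comp z h).contDiffAt

/-- The differential of a map, read in a chart. -/
lemma diff_mfderiv_chart_symm [IsManifold (𝓡 2) ∞ M] {y : M → E3}
    (hy : ContMDiff (𝓡 2) 𝓘(ℝ, E3) ∞ y)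
    {φ : OpenPartialHomeomorph M E2} (hφ : φ ∈ IsManifold.maximalAtlas (𝓡 2) ∞ M)
    {z : E2} (hz : z ∈ φ.target) (v : E2) :
    diff y (φ.symm z) (mfderiv (𝓡 2) (𝓡 2) φ.symm z v) = fderiv ℝ (y ∘ φ.symm) z v := by
  have h := (contMDiffAt_symm_of_mem_maximalAtlas hφ hz).mdifferentiableAt (by simp)
  have h' := (hy.contMDiffAt (x := φ.symm z)).mdifferentiableAt (by simp)
  have := mfderiv_comp z h' h
  rw [← mfderiv_eq_fderiv]
  exact (congrArg (fun L => L v) this).symm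

/-- At the base point of a preferred chart every tangent vector is its own coordinate vector. -/
lemma diff_eq_fderiv_chartAt [IsManifold (𝓡 2) ∞ M] {y : M → E3}
    (hy : ContMDiff (𝓡 2) 𝓘(ℝ, E3) ∞ y) (p : M) (X : TangentSpace (𝓡 2) p) :
    diff y p X = fderiv ℝ (y ∘ (chartAt E2 p).symm) (chartAt E2 p p) X := by
  have h' := (hy.contMDiffAt (x := p)).mdifferentiableAt (by simp)
  have h := congrArg (fun L : E2 →L[ℝ] E3 => L X) h'.mfderiv
  refine h.trans ?_
  simp only [writtenInExtChartAt, extChartAt, Function.comp_def, mfld_simps, fderivWithin_univ]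
  rfl

lemma trans_mem_maximalAtlas {φ : OpenPartialHomeomorph M E2}
    (hφ : φ ∈ IsManifold.maximalAtlas (𝓡 2) ∞ M) {g : OpenPartialHomeomorph E2 E2}
    (hg : g ∈ contDiffGroupoid ∞ (𝓡 2)) :
    φ ≫ₕ g ∈ IsManifold.maximalAtlas (𝓡 2) ∞ M := by
  rw [IsManifold.mem_maximalAtlas_iff] at hφ ⊢
  rw [mem_maximalAtlas_iff] at hφ ⊢
  intro e he
  obtain ⟨h1, h2⟩ := hφ e he
  constructor
  · rw [OpenPartialHomeomorph.trans_symm_eq_symm_trans_symm, OpenPartialHomeomorph.trans_assoc]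
    exact (contDiffGroupoid ∞ (𝓡 2)).trans ((contDiffGroupoid ∞ (𝓡 2)).symm hg) h1
  · rw [← OpenPartialHomeomorph.trans_assoc]
    exact (contDiffGroupoid ∞ (𝓡 2)).trans h2 hg

/-- Changing coordinates by a map with injective differential. -/
lemma exists_chart_comp [IsManifold (𝓡 2) ∞ M] {φ : OpenPartialHomeomorph M E2}
    (hφ : φ ∈ IsManifold.maximalAtlas (𝓡 2) ∞ M) {p : M} (hp : p ∈ φ.source) {f : E2 → E2}
    {U : Set E2} (hU : IsOpen U) (hpU : φ p ∈ U)
    (hf : ∀ z ∈ U, ContDiffAt ℝ ∞ f z) (hinj : ∀ z ∈ U, Function.Injective (fderiv ℝ f z)) :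
    ∃ φ' ∈ IsManifold.maximalAtlas (𝓡 2) ∞ M, p ∈ φ'.source ∧ ∀ z' ∈ φ'.target, ∃ z ∈ U,
      φ'.symm z' = φ.symm z ∧ ∀ y : M → E3, ContMDiff (𝓡 2) 𝓘(ℝ, E3) ∞ y → ∀ v : E2,
        fderiv ℝ (y ∘ φ'.symm) z' (fderiv ℝ f z v) = fderiv ℝ (y ∘ φ.symm) z v := by
  have hequiv : ∀ z ∈ U, ∃ L : E2 ≃L[ℝ] E2, HasFDerivAt f (L : E2 →L[ℝ] E2) z := by
    intro z hz
    refine ⟨(LinearEquiv.ofInjectiveEndo (fderiv ℝ f z : E2 →ₗ[ℝ] E2)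
      (hinj z hz)).toContinuousLinearEquiv, ?_⟩
    exact ((hf z hz).differentiableAt (by simp)).hasFDerivAt.congr_fderiv rfl
  obtain ⟨L, hL⟩ := hequiv _ hpU
  set g₀ := (hf _ hpU).toOpenPartialHomeomorph f hL (by simp) with hg₀
  set g := g₀.restrOpen U hU with hgdef
  have hg₀f : (g₀ : E2 → E2) = f := rfl
  have hgf : (g : E2 → E2) = f := rfl
  have hgs : g.source ⊆ U := fun z hz => by
    rw [hgdef, OpenPartialHomeomorph.restrOpen_source] at hz
    exact hz.2
  have hsymm : ∀ w ∈ g.target, ContDiffAt ℝ ∞ g.symm w := by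
    intro w hw
    have hm := hgs (g.map_target hw)
    obtain ⟨L', hL'⟩ := hequiv _ hm
    exact g.contDiffAt_symm hw hL' (hf _ hm)
  have hgm : g ∈ contDiffGroupoid ∞ (𝓡 2) := by
    rw [contDiffGroupoid, mem_groupoid_of_pregroupoid]
    simp only [contDiffPregroupoid]
    constructor
    · simp
      exact fun z hz => (hf z (hgs hz)).contDiffWithinAt
    · simp
      exact fun z hz => (hsymm z hz).contDiffWithinAt
  refine ⟨φ ≫ₕ g, trans_mem_maximalAtlas hφ hgm, ?_, ?_⟩
  · rw [OpenPartialHomeomorph.trans_source]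
    refine ⟨hp, ?_⟩
    simp only [Set.mem_preimage]
    rw [hgdef, OpenPartialHomeomorph.restrOpen_source]
    exact ⟨(hf _ hpU).mem_toOpenPartialHomeomorph_source hL (by simp), hpU⟩
  · intro z' hz'
    have hz't : z' ∈ g.target := by
      rw [OpenPartialHomeomorph.trans_target] at hz'
      exact hz'.1
    have hzs := g.map_target hz't
    refine ⟨g.symm z', hgs hzs, rfl, ?_⟩
    intro y hy v
    set z := g.symm z' with hz
    have hgz : f z = z' := g.right_inv hz't
    have hd' := (contDiffAt_comp_chart_symm hy (trans_mem_maximalAtlas hφ hgm) hz').differentiableAt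
      (by simp)
    rw [← hgz] at hd' ⊢
    have hdf := (hf z (hgs hzs)).differentiableAt (by simp)
    have hcomp := fderiv_comp z hd' hdf
    have heq : (y ∘ φ.symm) =ᶠ[nhds z] ((y ∘ (φ ≫ₕ g).symm) ∘ f) := by
      filter_upwards [g.open_source.mem_nhds hzs] with w hw
      have : g.symm (f w) = w := g.left_inv hw
      simp [this]
    rw [heq.fderiv_eq, hcomp]
    rfl

end Charts

/-- Differentiating `(dY, N) = 0` makes `(dY, dN)` symmetric. -/
lemma inner_fderiv_symm {Y N : E2 → E3} {z : E2} (hY : ContDiffAt ℝ ∞ Y z)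
    (hN : ContDiffAt ℝ ∞ N z) (hYN : ∀ᶠ w in nhds z, ∀ v, inner ℝ (fderiv ℝ Y w v) (N w) = 0)
    (v w : E2) :
    inner ℝ (fderiv ℝ Y z v) (fderiv ℝ N z w) = inner ℝ (fderiv ℝ Y z w) (fderiv ℝ N z v) := by
  have hdY : DifferentiableAt ℝ (fderiv ℝ Y) z :=
    (hY.fderiv_right (m := 1) (by norm_cast)).differentiableAt (by simp)
  have hdN : DifferentiableAt ℝ N z := hN.differentiableAt (by simp)
  have key : ∀ v w : E2, inner ℝ (fderiv ℝ (fderiv ℝ Y) z w v) (N z) +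
      inner ℝ (fderiv ℝ Y z v) (fderiv ℝ N z w) = 0 := by
    intro v w
    have h1 : HasFDerivAt (fun u => fderiv ℝ Y u v) ((fderiv ℝ (fderiv ℝ Y) z).flip v) z :=
      ((ContinuousLinearMap.apply ℝ E3 v).hasFDerivAt.comp z hdY.hasFDerivAt)
    have h2 := (h1.inner ℝ hdN.hasFDerivAt).fderiv
    have h3 : (fun u => inner ℝ (fderiv ℝ Y u v) (N u)) =ᶠ[nhds z] fun _ => (0 : ℝ) := by
      filter_upwards [hYN] with u hu using hu v
    rw [h3.fderiv_eq] at h2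
    have h4 := congrArg (fun L : E2 →L[ℝ] ℝ => L w) h2
    simp [fderivInnerCLM_apply] at h4
    linarith
  have hsymm : fderiv ℝ (fderiv ℝ Y) z v w = fderiv ℝ (fderiv ℝ Y) z w v :=
    (hY.isSymmSndFDerivAt (by simp; norm_cast)) v w
  have h1 := key v w
  have h2 := key w v
  rw [hsymm] at h2
  linarith

lemma Parallel.symm {v w : E3} (h : Parallel v w) : Parallel w v := by
  obtain ⟨a, b, hab, h⟩ := h
  exact ⟨b, a, hab.symm, by rw [add_comm, h]⟩

lemma Parallel.exists_eq_smul {v w : E3} (h : Parallel v w) (hw : w ≠ 0) : ∃ c : ℝ, v = c • w := by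
  obtain ⟨a, b, hab, h⟩ := h
  have ha : a ≠ 0 := by
    rintro rfl
    have hb : b ≠ 0 := by simpa using hab
    simp [hb, hw] at h
  refine ⟨-(a⁻¹ * b), ?_⟩
  rw [← inv_smul_smul₀ ha v, eq_neg_of_add_eq_zero_left h, smul_neg, smul_smul, neg_smul]

section Pointwise

variable {M : Type*} [TopologicalSpace M] [ChartedSpace E2 M] [IsManifold (𝓡 2) ∞ M]

lemma IsSurfaceWithNormal.inner_chart_eq_zero {x n : M → E3} (h : IsSurfaceWithNormal x n)
    {φ : OpenPartialHomeomorph M E2} (hφ : φ ∈ IsManifold.maximalAtlas (𝓡 2) ∞ M)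
    {z : E2} (hz : z ∈ φ.target) (v : E2) :
    inner ℝ (fderiv ℝ (x ∘ φ.symm) z v) ((n ∘ φ.symm) z) = 0 := by
  rw [← diff_mfderiv_chart_symm h.smooth hφ hz]
  exact h.orthogonal _ _

/-- The second fundamental form is symmetric. -/
lemma IsSurfaceWithNormal.inner_diff_symm {x n : M → E3} (h : IsSurfaceWithNormal x n) (p : M)
    (X Y : TangentSpace (𝓡 2) p) :
    inner ℝ (diff x p X) (diff n p Y) = inner ℝ (diff x p Y) (diff n p X) := by
  have hφ := IsManifold.chart_mem_maximalAtlas (I := 𝓡 2) (n := ∞) p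
  have hz : chartAt E2 p p ∈ (chartAt E2 p).target := mem_chart_target E2 p
  simp only [diff_eq_fderiv_chartAt h.smooth, diff_eq_fderiv_chartAt h.smooth_normal]
  refine inner_fderiv_symm (contDiffAt_comp_chart_symm h.smooth hφ hz)
    (contDiffAt_comp_chart_symm h.smooth_normal hφ hz) ?_ X Y
  filter_upwards [(chartAt E2 p).open_target.mem_nhds hz] with w hw v
  exact h.inner_chart_eq_zero hφ hw v

/-- Rodrigues' equations in a basis of common curvature directions. -/
lemma exists_principal_basis {xhat x n : M → E3} (hmin : IsMinimalSurface xhat n)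
    (humb : ∀ p : M, ¬ IsUmbilic xhat n p) (hcomb : IsCombescurePair n x xhat) (p : M) :
    ∃ (b : Module.Basis (Fin 2) ℝ (TangentSpace (𝓡 2) p)) (k : ℝ) (c : Fin 2 → ℝ), k ≠ 0 ∧
      (∀ i, diff n p (b i) ≠ 0) ∧ inner ℝ (diff n p (b 0)) (diff n p (b 1)) = 0 ∧
      diff xhat p (b 0) = k • diff n p (b 0) ∧ diff xhat p (b 1) = -k • diff n p (b 1) ∧
      ∀ i, diff x p (b i) = c i • diff n p (b i) := by
  obtain ⟨b, hb⟩ := hcomb.parallel p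
  obtain ⟨S, hS, htr⟩ := hmin.trace_shape p
  have hinj := hmin.immersion p
  have hne : ∀ i, diff xhat p (b i) ≠ 0 := fun i h =>
    b.ne_zero i (hinj (h.trans (map_zero (diff xhat p)).symm))
  have hk : ∀ i, ∃ κ : ℝ, diff n p (b i) = -(κ • diff xhat p (b i)) := by
    intro i
    obtain ⟨κ, h⟩ := (hb i).2.1.2.symm.exists_eq_smul (hne i)
    exact ⟨-κ, by rw [h, neg_smul, neg_neg]⟩
  choose κ hκ using hk
  have hSb : ∀ i, S (b i) = κ i • b i := by
    intro i
    apply hinj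
    rw [map_smul]
    have := hS (b i)
    rw [hκ i, neg_inj] at this
    exact this.symm
  have htr' : κ 0 + κ 1 = 0 := by
    rw [LinearMap.trace_eq_matrix_trace ℝ b, Matrix.trace] at htr
    simpa [LinearMap.toMatrix_apply, hSb] using htr
  have hκ1 : κ 1 = -κ 0 := by linarith
  have hκ0 : κ 0 ≠ 0 := by
    intro h0
    refine humb p ⟨0, 1, by simp, fun X => ?_⟩
    have hn : ((diff n p : TangentSpace (𝓡 2) p →L[ℝ] E3) : TangentSpace (𝓡 2) p →ₗ[ℝ] E3) = 0 := by
      refine b.ext fun i => ?_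
      have := hκ i
      fin_cases i <;> simp_all
    have := congrArg (fun L : TangentSpace (𝓡 2) p →ₗ[ℝ] E3 => L X) hn
    simpa using this
  have hκne : ∀ i, κ i ≠ 0 := by
    intro i
    fin_cases i
    · exact hκ0
    · simpa [hκ1] using hκ0
  have hnne : ∀ i, diff n p (b i) ≠ 0 := by
    intro i
    rw [hκ i, neg_ne_zero]
    exact smul_ne_zero (hκne i) (hne i)
  have hx0 : diff xhat p (b 0) = (-(κ 0)⁻¹) • diff n p (b 0) := by
    rw [hκ 0, smul_neg, neg_smul, neg_neg, smul_smul, inv_mul_cancel₀ hκ0, one_smul]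
  have hx1 : diff xhat p (b 1) = (-(-(κ 0)⁻¹)) • diff n p (b 1) := by
    rw [hκ 1, hκ1, neg_neg, smul_neg, neg_smul, smul_neg, neg_neg, smul_smul,
      inv_mul_cancel₀ hκ0, one_smul]
  choose c hc using fun i => (hb i).1.2.exists_eq_smul (hnne i)
  refine ⟨b, -(κ 0)⁻¹, c, by simpa using hκ0, hnne, ?_, hx0, hx1, hc⟩
  have h := hmin.surface.inner_diff_symm p (b 0) (b 1)
  rw [hx0, hx1, real_inner_smul_left, real_inner_smul_left,
      real_inner_comm (diff n p (b 0)) (diff n p (b 1))] at h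
  have h' : (κ 0)⁻¹ * inner ℝ (diff n p (b 0)) (diff n p (b 1)) = 0 := by linarith
  simpa [hκ0] using h'

/-- The second fundamental form of a Combescure transform of a minimal surface is a combination of
the second and third fundamental forms of that minimal surface. -/
lemma exists_secondForm_eq {xhat x n : M → E3} (hmin : IsMinimalSurface xhat n)
    (humb : ∀ p : M, ¬ IsUmbilic xhat n p) (hcomb : IsCombescurePair n x xhat) (p : M) :
    ∃ μ ν : ℝ, ∀ X Y : TangentSpace (𝓡 2) p,
      secondForm x n p X Y = μ * secondForm xhat n p X Y + ν * thirdForm n p X Y := by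
  obtain ⟨b, k, c, hk, -, horth, h0, h1, hc⟩ := exists_principal_basis hmin humb hcomb p
  have horth' : inner ℝ (diff n p (b 1)) (diff n p (b 0)) = 0 := by rwa [real_inner_comm]
  refine ⟨(c 0 - c 1) / (2 * k), -(c 0 + c 1) / 2, fun X Y => ?_⟩
  rw [← b.sum_repr X, ← b.sum_repr Y]
  simp only [secondForm, thirdForm, Fin.sum_univ_two, map_add, map_smul, h0, h1, hc,
    inner_add_left, inner_add_right, real_inner_smul_left, real_inner_smul_right, horth, horth']
  field_simp
  ring

/-- The second fundamental form of a minimal surface without umbilics, in a conformal frame of the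
third fundamental form. -/
lemma secondForm_conformal_frame {xhat x n : M → E3} (hmin : IsMinimalSurface xhat n)
    (humb : ∀ p : M, ¬ IsUmbilic xhat n p) (hcomb : IsCombescurePair n x xhat) (p : M)
    {X Y : TangentSpace (𝓡 2) p} (hXY : thirdForm n p X Y = 0)
    (hlen : thirdForm n p X X = thirdForm n p Y Y) (hpos : thirdForm n p X X ≠ 0) :
    secondForm xhat n p X X + secondForm xhat n p Y Y = 0 ∧
      (secondForm xhat n p X X ≠ 0 ∨ secondForm xhat n p X Y ≠ 0) := by
  obtain ⟨b, k, c, hk, hne, horth, h0, h1, -⟩ := exists_principal_basis hmin humb hcomb p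
  have horth' : inner ℝ (diff n p (b 1)) (diff n p (b 0)) = 0 := by rwa [real_inner_comm]
  have hE0 : 0 < inner ℝ (diff n p (b 0)) (diff n p (b 0)) := real_inner_self_pos.2 (hne 0)
  have hE1 : 0 < inner ℝ (diff n p (b 1)) (diff n p (b 1)) := real_inner_self_pos.2 (hne 1)
  rw [← b.sum_repr X, ← b.sum_repr Y] at *
  simp only [secondForm, thirdForm, Fin.sum_univ_two, map_add, map_smul, h0, h1,
    inner_add_left, inner_add_right, real_inner_smul_left, real_inner_smul_right, horth,
    horth'] at hXY hlen hpos ⊢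
  generalize inner ℝ (diff n p (b 0)) (diff n p (b 0)) = E at *
  generalize inner ℝ (diff n p (b 1)) (diff n p (b 1)) = F at *
  generalize b.repr X 0 = s at *
  generalize b.repr X 1 = t at *
  generalize b.repr Y 0 = s' at *
  generalize b.repr Y 1 = t' at *
  have hsq : (s * s * E + s' * s' * E) ^ 2 = (t * t * F + t' * t' * F) ^ 2 := by
    linear_combination (s * s * E - s' * s' * E - t * t * F + t' * t' * F) * hlen +
      4 * (s * s' * E - t * t' * F) * hXY
  have heq : s * s * E + s' * s' * E = t * t * F + t' * t' * F := by
    rw [sq_eq_sq₀ (by have := mul_self_nonneg s; have := mul_self_nonneg s'; positivity)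
      (by have := mul_self_nonneg t; have := mul_self_nonneg t'; positivity)] at hsq
    exact hsq
  refine ⟨by linear_combination (-k) * heq, ?_⟩
  by_contra! hcon
  obtain ⟨ha, hb⟩ := hcon
  have ha' : s * s * E = t * t * F := by
    apply mul_left_cancel₀ hk; linear_combination -ha
  have hb' : s * s' * E = t * t' * F := by
    apply mul_left_cancel₀ hk; linear_combination -hb
  have h1 : s * s' * E = 0 := by linarith
  have h2 : s * s * E + s' * s' * E = s * s * E + s * s * E := by linarith
  have h3 : s' * s' * E = s * s * E := by linarith
  have h4 : (s * s * E) * (s * s * E) = 0 := by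
    calc (s * s * E) * (s * s * E) = (s * s * E) * (s' * s' * E) := by rw [h3]
      _ = (s * s' * E) * (s * s' * E) := by ring
      _ = 0 := by rw [h1, mul_zero]
  have h5 : s * s * E = 0 := mul_self_eq_zero.1 h4
  apply hpos
  linarith

/-- The normal of a minimal surface without umbilics is an immersion. -/
lemma diff_normal_injective {xhat x n : M → E3} (hmin : IsMinimalSurface xhat n)
    (humb : ∀ p : M, ¬ IsUmbilic xhat n p) (hcomb : IsCombescurePair n x xhat) (p : M)
    {X : TangentSpace (𝓡 2) p} (hX : diff n p X = 0) : X = 0 := by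
  obtain ⟨b, k, c, hk, hne, horth, h0, h1, -⟩ := exists_principal_basis hmin humb hcomb p
  have hE0 := real_inner_self_pos.2 (hne 0)
  have hE1 := real_inner_self_pos.2 (hne 1)
  have horth' : inner ℝ (diff n p (b 1)) (diff n p (b 0)) = 0 := by rwa [real_inner_comm]
  have e0 : inner ℝ (diff n p X) (diff n p (b 0)) = 0 := by rw [hX, inner_zero_left]
  have e1 : inner ℝ (diff n p X) (diff n p (b 1)) = 0 := by rw [hX, inner_zero_left]
  rw [← b.sum_repr X] at e0 e1 ⊢
  simp only [Fin.sum_univ_two, map_add, map_smul, inner_add_left, real_inner_smul_left, horth,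
    horth', mul_zero, add_zero, zero_add, mul_eq_zero, hE0.ne', hE1.ne', or_false] at e0 e1 ⊢
  rw [e0, e1, zero_smul, zero_smul, add_zero]

end Pointwise

/-- Stereographic projection of the unit sphere from the pole `(0, 0, -s)`, where `s = ±1`. -/
noncomputable def stereo (s : ℝ) (N : E3) : E2 :=
  WithLp.toLp 2 ![N 0 / (1 + s * N 2), N 1 / (1 + s * N 2)]

lemma contDiffAt_stereo {s : ℝ} {N : E3} (h : 1 + s * N 2 ≠ 0) :
    ContDiffAt ℝ ∞ (stereo s) N := by
  rw [contDiffAt_euclidean]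
  intro i
  fin_cases i
  · have : ContDiffAt ℝ ∞ (fun N : E3 => N 0 / (1 + s * N 2)) N := by
      fun_prop (disch := exact h)
    simpa [stereo] using this
  · have : ContDiffAt ℝ ∞ (fun N : E3 => N 1 / (1 + s * N 2)) N := by
      fun_prop (disch := exact h)
    simpa [stereo] using this

lemma fderiv_stereo_apply {s : ℝ} {N : E3} (h : 1 + s * N 2 ≠ 0) (m : E3) :
    fderiv ℝ (stereo s) N m =
      WithLp.toLp 2 ![(m 0 * (1 + s * N 2) - s * N 0 * m 2) / (1 + s * N 2) ^ 2,
        (m 1 * (1 + s * N 2) - s * N 1 * m 2) / (1 + s * N 2) ^ 2] := by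
  have hd := (contDiffAt_stereo h).differentiableAt (by simp)
  have hproj : ∀ (j : Fin 3), HasFDerivAt (fun N : E3 => N j)
      (EuclideanSpace.proj j : E3 →L[ℝ] ℝ) N := fun j =>
    (EuclideanSpace.proj (𝕜 := ℝ) j : E3 →L[ℝ] ℝ).hasFDerivAt
  have hcomp : ∀ (i : Fin 2) (j : Fin 3), (∀ N : E3, stereo s N i = N j / (1 + s * N 2)) →
      fderiv ℝ (stereo s) N m i = (m j * (1 + s * N 2) - s * N j * m 2) / (1 + s * N 2) ^ 2 := by
    intro i j hij
    have h1 := (EuclideanSpace.proj (𝕜 := ℝ) i : E2 →L[ℝ] ℝ).hasFDerivAt.comp N hd.hasFDerivAt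
    have h2 := (hproj j).mul
      ((hasDerivAt_inv h).comp_hasFDerivAt N (((hproj 2).const_mul s).const_add 1))
    have hfun : (EuclideanSpace.proj (𝕜 := ℝ) i : E2 →L[ℝ] ℝ) ∘ stereo s =
        (fun N : E3 => N j) * (Inv.inv ∘ fun N : E3 => 1 + s * N 2) := by
      funext N
      simpa [div_eq_mul_inv] using hij N
    rw [hfun] at h1
    have h3 := congrArg (fun L : E3 →L[ℝ] ℝ => L m) (h1.unique h2)
    simp at h3

    rw [h3]
    field_simp
    ring
  ext i
  fin_cases i
  · exact hcomp 0 0 fun _ => rfl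
  · exact hcomp 1 1 fun _ => rfl

/-- Stereographic projection is conformal. -/
lemma inner_fderiv_stereo {s : ℝ} (hs : s ^ 2 = 1) {N : E3} (hN : ‖N‖ = 1)
    (h : 1 + s * N 2 ≠ 0) {m m' : E3} (hm : inner ℝ m N = 0) (hm' : inner ℝ m' N = 0) :
    (1 + s * N 2) ^ 2 * inner ℝ (fderiv ℝ (stereo s) N m) (fderiv ℝ (stereo s) N m') =
      inner ℝ m m' := by
  have hN' : inner ℝ N N = (1 : ℝ) := by rw [real_inner_self_eq_norm_sq, hN, one_pow]
  rw [fderiv_stereo_apply h, fderiv_stereo_apply h]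
  simp only [PiLp.inner_apply, Fin.sum_univ_two, Fin.sum_univ_three, RCLike.inner_apply,
    conj_trivial] at hm hm' hN' ⊢
  simp only [Matrix.cons_val_zero, Matrix.cons_val_one]
  field_simp
  linear_combination (-s * (1 + s * N 2) * m' 2) * hm - s * (1 + s * N 2) * m 2 * hm' +
    s ^ 2 * m 2 * m' 2 * hN' + m 2 * m' 2 * hs

section

variable {M : Type*} [TopologicalSpace M] [ChartedSpace E2 M]

lemma mfderiv_chart_symm_injective {φ : OpenPartialHomeomorph M E2}
    (hφ : φ ∈ IsManifold.maximalAtlas (𝓡 2) ∞ M) {z : E2} (hz : z ∈ φ.target) :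
    Function.Injective (mfderiv (𝓡 2) (𝓡 2) φ.symm z) := by
  have h := (contMDiffAt_symm_of_mem_maximalAtlas hφ hz).mdifferentiableAt (by simp)
  have h' := (contMDiffAt_of_mem_maximalAtlas hφ (φ.map_target hz)).mdifferentiableAt (by simp)
  have hcomp := mfderiv_comp z h' h
  have heq : φ ∘ φ.symm =ᶠ[nhds z] id := by
    filter_upwards [φ.open_target.mem_nhds hz] with w hw using φ.right_inv hw
  rw [heq.mfderiv_eq, mfderiv_id] at hcomp
  intro v w hvw
  have h1 := congrArg (fun L : E2 →L[ℝ] E2 => L v) hcomp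
  have h2 := congrArg (fun L : E2 →L[ℝ] E2 => L w) hcomp
  refine h1.trans (Eq.trans ?_ h2.symm)
  exact congrArg (fun u => mfderiv (𝓡 2) (𝓡 2) φ (φ.symm z) u) hvw

lemma inner_fderiv_normal_eq_zero [IsManifold (𝓡 2) ∞ M] {n : M → E3} (hn : ContMDiff (𝓡 2) 𝓘(ℝ, E3) ∞ n)
    (hnorm : ∀ p, ‖n p‖ = 1) {φ : OpenPartialHomeomorph M E2}
    (hφ : φ ∈ IsManifold.maximalAtlas (𝓡 2) ∞ M) {z : E2} (hz : z ∈ φ.target) (v : E2) :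
    inner ℝ (fderiv ℝ (n ∘ φ.symm) z v) ((n ∘ φ.symm) z) = 0 := by
  have hd := ((contDiffAt_comp_chart_symm hn hφ hz).differentiableAt (by simp)).hasFDerivAt
  have h := (hd.inner ℝ hd).fderiv
  have hc : (fun w => inner ℝ ((n ∘ φ.symm) w) ((n ∘ φ.symm) w)) = fun _ => (1 : ℝ) := by
    funext w
    rw [real_inner_self_eq_norm_sq, Function.comp_apply, hnorm, one_pow]
  rw [hc] at h
  have h4 := congrArg (fun L : E2 →L[ℝ] ℝ => L v) h
  simp [fderivInnerCLM_apply] at h4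
  rw [real_inner_comm] at h4
  simp only [Function.comp_apply]
  rw [real_inner_comm] at h4 ⊢
  linarith

/-- An immersed unit normal admits charts that are conformal for the third fundamental form. -/
lemma exists_conformal_chart [IsManifold (𝓡 2) ∞ M] {n : M → E3} (hn : ContMDiff (𝓡 2) 𝓘(ℝ, E3) ∞ n)
    (hnorm : ∀ p, ‖n p‖ = 1)
    (himm : ∀ (p : M) (X : TangentSpace (𝓡 2) p), diff n p X = 0 → X = 0) (p : M) :
    ∃ φ ∈ IsManifold.maximalAtlas (𝓡 2) ∞ M, p ∈ φ.source ∧ ∀ z ∈ φ.target, ∃ ρ : ℝ, 0 < ρ ∧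
      ∀ v w : E2, inner ℝ (fderiv ℝ (n ∘ φ.symm) z v) (fderiv ℝ (n ∘ φ.symm) z w) =
        ρ * inner ℝ v w := by
  obtain ⟨s, hs, hsp⟩ : ∃ s : ℝ, s ^ 2 = 1 ∧ 1 + s * n p 2 ≠ 0 := by
    by_cases h : 1 + 1 * n p 2 = 0
    · exact ⟨-1, by norm_num, by intro h'; linarith⟩
    · exact ⟨1, by norm_num, h⟩
  set φ := chartAt E2 p
  have hφ : φ ∈ IsManifold.maximalAtlas (𝓡 2) ∞ M :=
    IsManifold.chart_mem_maximalAtlas (I := 𝓡 2) (n := ∞) p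
  have hp : p ∈ φ.source := mem_chart_source E2 p
  set N := n ∘ φ.symm with hN
  have hNs : ∀ z ∈ φ.target, ContDiffAt ℝ ∞ N z := fun z hz => contDiffAt_comp_chart_symm hn hφ hz
  set U := φ.target ∩ N ⁻¹' {m : E3 | 1 + s * m 2 ≠ 0}
  have hNc : ContinuousOn N φ.target := fun z hz => (hNs z hz).continuousAt.continuousWithinAt
  have hU : IsOpen U := by
    refine hNc.isOpen_inter_preimage φ.open_target ?_
    exact isOpen_ne_fun (by fun_prop) (by fun_prop)
  have hpU : φ p ∈ U := ⟨φ.map_source hp, by simpa [hN, φ.left_inv hp] using hsp⟩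
  have hf : ∀ z ∈ U, ContDiffAt ℝ ∞ (stereo s ∘ N) z := fun z hz =>
    (contDiffAt_stereo hz.2).comp z (hNs z hz.1)
  have hconf : ∀ z ∈ U, ∀ v w, (1 + s * N z 2) ^ 2 * inner ℝ (fderiv ℝ (stereo s ∘ N) z v)
      (fderiv ℝ (stereo s ∘ N) z w) = inner ℝ (fderiv ℝ N z v) (fderiv ℝ N z w) := by
    intro z hz v w
    rw [fderiv_comp z ((contDiffAt_stereo hz.2).differentiableAt (by simp))
      ((hNs z hz.1).differentiableAt (by simp))]
    exact inner_fderiv_stereo hs (hnorm _) hz.2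
      (inner_fderiv_normal_eq_zero hn hnorm hφ hz.1 v)
      (inner_fderiv_normal_eq_zero hn hnorm hφ hz.1 w)
  have hinj : ∀ z ∈ U, Function.Injective (fderiv ℝ (stereo s ∘ N) z) := by
    intro z hz
    rw [injective_iff_map_eq_zero]
    intro v hv
    have h1 := hconf z hz v v
    rw [hv, inner_zero_left, mul_zero, eq_comm, inner_self_eq_zero,
      ← diff_mfderiv_chart_symm hn hφ hz.1] at h1
    have h2 := himm _ _ h1
    exact mfderiv_chart_symm_injective hφ hz.1 (h2.trans (map_zero _).symm)
  obtain ⟨φ', hφ', hp', h⟩ := exists_chart_comp hφ hp hU hpU hf hinj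
  refine ⟨φ', hφ', hp', fun z' hz' => ?_⟩
  obtain ⟨z, hz, -, hy⟩ := h z' hz'
  refine ⟨(1 + s * N z 2) ^ 2, by have h0 : 1 + s * N z 2 ≠ 0 := hz.2; positivity, fun v w => ?_⟩
  have hsurj : Function.Surjective (fderiv ℝ (stereo s ∘ N) z) :=
    LinearMap.surjective_of_injective (f := (fderiv ℝ (stereo s ∘ N) z : E2 →ₗ[ℝ] E2)) (hinj z hz)
  obtain ⟨v, rfl⟩ := hsurj v
  obtain ⟨w, rfl⟩ := hsurj w
  rw [hy n hn, hy n hn, hconf z hz]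

end

/-- In `ℝ³`, a vector orthogonal to three pairwise orthogonal nonzero vectors vanishes. -/
lemma eq_zero_of_inner_eq_zero {a b c v : E3} (ha : a ≠ 0) (hb : b ≠ 0) (hc : c ≠ 0)
    (hab : inner ℝ a b = 0) (hac : inner ℝ a c = 0) (hbc : inner ℝ b c = 0)
    (hva : inner ℝ v a = 0) (hvb : inner ℝ v b = 0) (hvc : inner ℝ v c = 0) : v = 0 := by
  by_contra hv
  have hli : LinearIndependent ℝ ![v, a, b, c] := by
    refine linearIndependent_of_ne_zero_of_inner_eq_zero (𝕜 := ℝ) ?_ ?_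
    · intro i
      fin_cases i <;> assumption
    · intro i j hij
      fin_cases i <;> fin_cases j <;>
        first
        | exact absurd rfl hij
        | assumption
        | (rw [real_inner_comm]; assumption)
  have := hli.fintype_card_le_finrank
  simp at this

/-- The standard basis vectors of the coordinate plane. -/
noncomputable abbrev stdVec (i : Fin 2) : E2 := EuclideanSpace.single i (1 : ℝ)

lemma inner_stdVec (i j : Fin 2) : inner ℝ (stdVec i) (stdVec j) = if i = j then (1 : ℝ) else 0 := by
  rw [EuclideanSpace.inner_single_left]
  fin_cases i <;> fin_cases j <;> simp [stdVec]

/-- The form `-(dY, dN)` of maps on the coordinate plane. -/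
noncomputable def formCoeff (Y N : E2 → E3) (i j : Fin 2) (z : E2) : ℝ :=
  -inner ℝ (fderiv ℝ Y z (stdVec i)) (fderiv ℝ N z (stdVec j))

lemma hasFDerivAt_inner_fderiv {Y N : E2 → E3} {z : E2} (hY : ContDiffAt ℝ ∞ Y z)
    (hN : ContDiffAt ℝ ∞ N z) (v w : E2) :
    DifferentiableAt ℝ (fun u => inner ℝ (fderiv ℝ Y u v) (fderiv ℝ N u w)) z ∧
    ∀ t, fderiv ℝ (fun u => inner ℝ (fderiv ℝ Y u v) (fderiv ℝ N u w)) z t =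
      inner ℝ (fderiv ℝ (fderiv ℝ Y) z t v) (fderiv ℝ N z w) +
        inner ℝ (fderiv ℝ Y z v) (fderiv ℝ (fderiv ℝ N) z t w) := by
  have hd : ∀ {Z : E2 → E3}, ContDiffAt ℝ ∞ Z z → ∀ v, HasFDerivAt (fun u => fderiv ℝ Z u v)
      ((fderiv ℝ (fderiv ℝ Z) z).flip v) z := by
    intro Z hZ v
    have hdZ : DifferentiableAt ℝ (fderiv ℝ Z) z :=
      (hZ.fderiv_right (m := 1) (by norm_cast)).differentiableAt (by simp)
    exact (ContinuousLinearMap.apply ℝ E3 v).hasFDerivAt.comp z hdZ.hasFDerivAt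
  have h := (hd hY v).inner ℝ (hd hN w)
  refine ⟨h.differentiableAt, fun t => ?_⟩
  rw [h.fderiv]
  simp [fderivInnerCLM_apply, add_comm]

/-- The Codazzi equations of a minimal surface in coordinates that are conformal for the third
fundamental form are Cauchy-Riemann equations. -/
lemma codazzi_conformal {Y N : E2 → E3} {U : Set E2} (hU : IsOpen U)
    (hY : ∀ z ∈ U, ContDiffAt ℝ ∞ Y z) (hN : ∀ z ∈ U, ContDiffAt ℝ ∞ N z)
    (hYN : ∀ z ∈ U, ∀ v, inner ℝ (fderiv ℝ Y z v) (N z) = 0)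
    (hNN : ∀ z ∈ U, ∀ v, inner ℝ (fderiv ℝ N z v) (N z) = 0) (hN0 : ∀ z ∈ U, N z ≠ 0)
    (hconf : ∀ z ∈ U, ∃ ρ : ℝ, 0 < ρ ∧ ∀ v w : E2,
      inner ℝ (fderiv ℝ N z v) (fderiv ℝ N z w) = ρ * inner ℝ v w)
    (htr : ∀ z ∈ U, formCoeff Y N 0 0 z + formCoeff Y N 1 1 z = 0) {z : E2} (hz : z ∈ U) :
    fderiv ℝ (formCoeff Y N 0 0) z (stdVec 1) = fderiv ℝ (formCoeff Y N 0 1) z (stdVec 0) ∧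
      fderiv ℝ (formCoeff Y N 0 0) z (stdVec 0) = -fderiv ℝ (formCoeff Y N 0 1) z (stdVec 1) := by
  have hUz : U ∈ nhds z := hU.mem_nhds hz
  have hsymmN : ∀ v w, fderiv ℝ (fderiv ℝ N) z v w = fderiv ℝ (fderiv ℝ N) z w v :=
    fun v w => ((hN z hz).isSymmSndFDerivAt (by simp; norm_cast)) v w
  have hsymmY : ∀ v w, fderiv ℝ (fderiv ℝ Y) z v w = fderiv ℝ (fderiv ℝ Y) z w v :=
    fun v w => ((hY z hz).isSymmSndFDerivAt (by simp; norm_cast)) v w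
  have hYNsymm : ∀ w ∈ U, formCoeff Y N 0 1 w = formCoeff Y N 1 0 w := by
    intro w hw
    rw [formCoeff, formCoeff, inner_fderiv_symm (hY w hw) (hN w hw)]
    filter_upwards [hU.mem_nhds hw] with u hu using hYN u hu
  have hderiv : ∀ i j t, fderiv ℝ (formCoeff Y N i j) z t =
      -(inner ℝ (fderiv ℝ (fderiv ℝ Y) z t (stdVec i)) (fderiv ℝ N z (stdVec j)) +
        inner ℝ (fderiv ℝ Y z (stdVec i)) (fderiv ℝ (fderiv ℝ N) z t (stdVec j))) := by
    intro i j t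
    rw [← (hasFDerivAt_inner_fderiv (hY z hz) (hN z hz) _ _).2 t]
    unfold formCoeff
    rw [fderiv_fun_neg]
    rfl
  have e1 : fderiv ℝ (formCoeff Y N 0 1) z = fderiv ℝ (formCoeff Y N 1 0) z := by
    apply Filter.EventuallyEq.fderiv_eq
    filter_upwards [hUz] with w hw using hYNsymm w hw
  have e2 : fderiv ℝ (formCoeff Y N 0 0) z = -fderiv ℝ (formCoeff Y N 1 1) z := by
    rw [← fderiv_neg]
    apply Filter.EventuallyEq.fderiv_eq
    filter_upwards [hUz] with w hw
    have := htr w hw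
    simp only [Pi.neg_apply]
    linarith
  have c1 : ∀ t, inner ℝ (fderiv ℝ (fderiv ℝ N) z t (stdVec 0)) (fderiv ℝ N z (stdVec 0)) =
      inner ℝ (fderiv ℝ (fderiv ℝ N) z t (stdVec 1)) (fderiv ℝ N z (stdVec 1)) := by
    intro t
    have h0 := (hasFDerivAt_inner_fderiv (hN z hz) (hN z hz) (stdVec 0) (stdVec 0)).2 t
    have h1 := (hasFDerivAt_inner_fderiv (hN z hz) (hN z hz) (stdVec 1) (stdVec 1)).2 t
    have heq : (fun u => inner ℝ (fderiv ℝ N u (stdVec 0)) (fderiv ℝ N u (stdVec 0))) =ᶠ[nhds z]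
        fun u => inner ℝ (fderiv ℝ N u (stdVec 1)) (fderiv ℝ N u (stdVec 1)) := by
      filter_upwards [hUz] with w hw
      obtain ⟨ρ, -, h⟩ := hconf w hw
      rw [h, h, inner_stdVec, inner_stdVec, if_pos rfl, if_pos rfl]
    rw [heq.fderiv_eq, h1] at h0
    linarith [real_inner_comm (fderiv ℝ (fderiv ℝ N) z t (stdVec 0)) (fderiv ℝ N z (stdVec 0)),
      real_inner_comm (fderiv ℝ (fderiv ℝ N) z t (stdVec 1)) (fderiv ℝ N z (stdVec 1))]
  have c2 : ∀ t, inner ℝ (fderiv ℝ (fderiv ℝ N) z t (stdVec 0)) (fderiv ℝ N z (stdVec 1)) =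
      -inner ℝ (fderiv ℝ (fderiv ℝ N) z t (stdVec 1)) (fderiv ℝ N z (stdVec 0)) := by
    intro t
    have h0 := (hasFDerivAt_inner_fderiv (hN z hz) (hN z hz) (stdVec 0) (stdVec 1)).2 t
    have heq : (fun u => inner ℝ (fderiv ℝ N u (stdVec 0)) (fderiv ℝ N u (stdVec 1))) =ᶠ[nhds z]
        fun _ => (0 : ℝ) := by
      filter_upwards [hUz] with w hw
      obtain ⟨ρ, -, h⟩ := hconf w hw
      rw [h, inner_stdVec, if_neg (by simp), mul_zero]
    rw [heq.fderiv_eq] at h0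
    simp at h0
    linarith [real_inner_comm (fderiv ℝ (fderiv ℝ N) z t (stdVec 1)) (fderiv ℝ N z (stdVec 0))]
  obtain ⟨ρ, hρ, hρz⟩ := hconf z hz
  have n00 : inner ℝ (fderiv ℝ N z (stdVec 0)) (fderiv ℝ N z (stdVec 0)) = ρ := by
    rw [hρz, inner_stdVec, if_pos rfl, mul_one]
  have n11 : inner ℝ (fderiv ℝ N z (stdVec 1)) (fderiv ℝ N z (stdVec 1)) = ρ := by
    rw [hρz, inner_stdVec, if_pos rfl, mul_one]
  have n01 : inner ℝ (fderiv ℝ N z (stdVec 0)) (fderiv ℝ N z (stdVec 1)) = 0 := by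
    rw [hρz, inner_stdVec, if_neg (by simp), mul_zero]
  have n10 : inner ℝ (fderiv ℝ N z (stdVec 1)) (fderiv ℝ N z (stdVec 0)) = 0 := by
    rw [hρz, inner_stdVec, if_neg (by simp), mul_zero]
  have hne : ∀ i, inner ℝ (fderiv ℝ N z (stdVec i)) (fderiv ℝ N z (stdVec i)) = ρ →
      fderiv ℝ N z (stdVec i) ≠ 0 := by
    intro i h h0
    rw [h0, inner_zero_left] at h
    exact hρ.ne h
  have hexp : ∀ i, ρ • fderiv ℝ Y z (stdVec i) = -(formCoeff Y N i 0 z • fderiv ℝ N z (stdVec 0) +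
      formCoeff Y N i 1 z • fderiv ℝ N z (stdVec 1)) := by
    intro i
    rw [eq_neg_iff_add_eq_zero]
    refine eq_zero_of_inner_eq_zero (hN0 z hz) (hne 0 n00) (hne 1 n11)
      (by rw [real_inner_comm]; exact hNN z hz _) (by rw [real_inner_comm]; exact hNN z hz _)
      n01 ?_ ?_ ?_ <;>
    simp only [inner_add_left, real_inner_smul_left, hYN z hz, hNN z hz, n00, n11, n01, n10,
      formCoeff] <;> ring
  have hin : ∀ i m, ρ * inner ℝ (fderiv ℝ Y z (stdVec i)) m =
      -(formCoeff Y N i 0 z * inner ℝ m (fderiv ℝ N z (stdVec 0)) +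
      formCoeff Y N i 1 z * inner ℝ m (fderiv ℝ N z (stdVec 1))) := by
    intro i m
    rw [← real_inner_smul_left, hexp, inner_neg_left, inner_add_left, real_inner_smul_left,
      real_inner_smul_left, real_inner_comm m, real_inner_comm m]
  have hs := hYNsymm z hz
  have ht := htr z hz
  have ht' : formCoeff Y N 1 1 z = -formCoeff Y N 0 0 z := by linarith
  have k1 : inner ℝ (fderiv ℝ Y z (stdVec 0)) (fderiv ℝ (fderiv ℝ N) z (stdVec 1) (stdVec 0)) =
      inner ℝ (fderiv ℝ Y z (stdVec 1)) (fderiv ℝ (fderiv ℝ N) z (stdVec 0) (stdVec 0)) := by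
    apply mul_left_cancel₀ hρ.ne'
    rw [hin, hin, c2 (stdVec 0), c1 (stdVec 0), hsymmN (stdVec 1) (stdVec 0), ht', ← hs]
    ring
  have k2 : inner ℝ (fderiv ℝ Y z (stdVec 1)) (fderiv ℝ (fderiv ℝ N) z (stdVec 0) (stdVec 1)) =
      inner ℝ (fderiv ℝ Y z (stdVec 0)) (fderiv ℝ (fderiv ℝ N) z (stdVec 1) (stdVec 1)) := by
    apply mul_left_cancel₀ hρ.ne'
    have c1' := c1 (stdVec 1)
    have c2' := c2 (stdVec 1)
    rw [hin, hin, hsymmN (stdVec 0) (stdVec 1), c1', c2', ht', ← hs]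
    ring
  constructor
  · rw [e1, hderiv, hderiv, k1, hsymmY (stdVec 1) (stdVec 0)]
  · rw [e2, neg_apply, hderiv, hderiv, k2, hsymmY (stdVec 1) (stdVec 0)]

/-- The Hopf differential `-(dY, dN)(∂_z, ∂_z)` of a minimal surface is holomorphic. -/
lemma hopf_differentiableAt {Y N : E2 → E3} {z : ℂ}
    (hY : ContDiffAt ℝ ∞ Y (Complex.orthonormalBasisOneI.repr z))
    (hN : ContDiffAt ℝ ∞ N (Complex.orthonormalBasisOneI.repr z))
    (h1 : fderiv ℝ (formCoeff Y N 0 0) (Complex.orthonormalBasisOneI.repr z) (stdVec 1) =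
      fderiv ℝ (formCoeff Y N 0 1) (Complex.orthonormalBasisOneI.repr z) (stdVec 0))
    (h2 : fderiv ℝ (formCoeff Y N 0 0) (Complex.orthonormalBasisOneI.repr z) (stdVec 0) =
      -fderiv ℝ (formCoeff Y N 0 1) (Complex.orthonormalBasisOneI.repr z) (stdVec 1)) :
    DifferentiableAt ℂ (fun w : ℂ => (1 / 2 : ℂ) *
      ((formCoeff Y N 0 0 (Complex.orthonormalBasisOneI.repr w) : ℂ) -
        Complex.I * (formCoeff Y N 0 1 (Complex.orthonormalBasisOneI.repr w) : ℂ))) z := by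
  set e : ℂ ≃ₗᵢ[ℝ] E2 := Complex.orthonormalBasisOneI.repr with he
  have hd : ∀ i j, HasFDerivAt (formCoeff Y N i j) (fderiv ℝ (formCoeff Y N i j) (e z)) (e z) :=
    fun i j => (hasFDerivAt_inner_fderiv hY hN _ _).1.neg.hasFDerivAt
  have hc : ∀ i j, HasFDerivAt (fun w : ℂ => (formCoeff Y N i j (e w) : ℂ))
      (Complex.ofRealCLM.comp ((fderiv ℝ (formCoeff Y N i j) (e z)).comp
        (e.toContinuousLinearEquiv : ℂ →L[ℝ] E2))) z := fun i j =>
    Complex.ofRealCLM.hasFDerivAt.comp z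
      ((hd i j).comp z (e.toContinuousLinearEquiv : ℂ →L[ℝ] E2).hasFDerivAt)
  have e1 : e 1 = stdVec 0 := by
    ext i; fin_cases i <;> simp [he, stdVec]
  have eI : e Complex.I = stdVec 1 := by
    ext i; fin_cases i <;> simp [he, stdVec]
  have hD := ((hc 0 0).sub ((hc 0 1).const_mul Complex.I)).const_mul (1 / 2 : ℂ)
  rw [differentiableAt_complex_iff_differentiableAt_real]
  refine ⟨hD.differentiableAt, ?_⟩
  have hD' := hD.fderiv
  have hD'' := fun v => congrArg (fun L : ℂ →L[ℝ] ℂ => L v) hD'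
  refine (hD'' _).trans (Eq.trans ?_ (congrArg (Complex.I • ·) (hD'' _)).symm)
  simp [e1, eI, h1, h2]
  linear_combination (1 / 2 * (fderiv ℝ (formCoeff Y N 0 1) (e z) (stdVec 0) : ℂ)) * Complex.I_sq

/-- A nonvanishing holomorphic function `H` is locally the square of a derivative. -/
lemma exists_primitive_sqrt {H : ℂ → ℂ} {V : Set ℂ} (hV : IsOpen V)
    (hH : ∀ z ∈ V, DifferentiableAt ℂ H z) {z₀ : ℂ} (hz₀ : z₀ ∈ V) (h0 : H z₀ ≠ 0) :
    ∃ (W : Set ℂ) (G g : ℂ → ℂ), IsOpen W ∧ z₀ ∈ W ∧ W ⊆ V ∧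
      ∀ z ∈ W, ContDiffAt ℝ ∞ G z ∧ HasDerivAt G (g z) z ∧ g z ≠ 0 ∧ g z ^ 2 = H z := by
  obtain ⟨c, hc⟩ := IsAlgClosed.exists_pow_nat_eq (H z₀) two_pos
  have hc0 : c ≠ 0 := by
    rintro rfl
    exact h0 (by simpa using hc.symm)
  have hcont : ContinuousAt (fun z => H z / H z₀) z₀ := (hH z₀ hz₀).continuousAt.div_const _
  have hmem : (fun z => H z / H z₀) ⁻¹' Complex.slitPlane ∩ V ∈ nhds z₀ := by
    refine Filter.inter_mem (hcont.preimage_mem_nhds ?_) (hV.mem_nhds hz₀)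
    rw [div_self h0]
    exact Complex.isOpen_slitPlane.mem_nhds Complex.one_mem_slitPlane
  obtain ⟨r, hr, hball⟩ := Metric.mem_nhds_iff.1 hmem
  set g : ℂ → ℂ := fun z => c * Complex.exp (Complex.log (H z / H z₀) / 2)
  have hg : DifferentiableOn ℂ g (Metric.ball z₀ r) := by
    intro z hz
    have h1 : DifferentiableAt ℂ (fun z => Complex.log (H z / H z₀)) z :=
      ((hH z (hball hz).2).div_const _).clog (hball hz).1
    exact ((h1.div_const 2).cexp.const_mul c).differentiableWithinAt
  obtain ⟨G, hG⟩ := hg.isExactOn_ball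
  refine ⟨Metric.ball z₀ r, G, g, Metric.isOpen_ball, Metric.mem_ball_self hr,
    fun z hz => (hball hz).2, fun z hz => ⟨?_, hG z hz, ?_, ?_⟩⟩
  · have hGd : DifferentiableOn ℂ G (Metric.ball z₀ r) := fun w hw =>
      (hG w hw).differentiableAt.differentiableWithinAt
    exact ((hGd.analyticAt (Metric.isOpen_ball.mem_nhds hz)).contDiffAt.restrict_scalars ℝ).of_le
      le_top
  · exact mul_ne_zero hc0 (Complex.exp_ne_zero _)
  · have hne : H z / H z₀ ≠ 0 := Complex.slitPlane_ne_zero (hball hz).1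
    simp only [g]
    rw [mul_pow, ← Complex.exp_nat_mul, hc]
    push_cast
    rw [mul_div_cancel₀ _ two_ne_zero, Complex.exp_log hne]
    field_simp

section

variable {M : Type*} [TopologicalSpace M] [ChartedSpace E2 M]

/-- `φ` is a conformal chart of the third fundamental form in which the second fundamental form of
the surface is `2 (du² - dv²)`. -/
structure IsHopfChart (xhat n : M → E3) (φ : OpenPartialHomeomorph M E2) : Prop where
  mem_atlas : φ ∈ IsManifold.maximalAtlas (𝓡 2) ∞ M
  conformal : ∀ z ∈ φ.target, ∃ ρ : ℝ, 0 < ρ ∧ ∀ i j : Fin 2,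
    thirdForm n (φ.symm z) (coordVec φ z i) (coordVec φ z j) = if i = j then ρ else 0
  form00 : ∀ z ∈ φ.target, secondForm xhat n (φ.symm z) (coordVec φ z 0) (coordVec φ z 0) = 2
  form11 : ∀ z ∈ φ.target, secondForm xhat n (φ.symm z) (coordVec φ z 1) (coordVec φ z 1) = -2
  form01 : ∀ z ∈ φ.target, secondForm xhat n (φ.symm z) (coordVec φ z 0) (coordVec φ z 1) = 0

lemma secondForm_coordVec [IsManifold (𝓡 2) ∞ M] {x n : M → E3}
    (hx : ContMDiff (𝓡 2) 𝓘(ℝ, E3) ∞ x) (hn : ContMDiff (𝓡 2) 𝓘(ℝ, E3) ∞ n)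
    {φ : OpenPartialHomeomorph M E2} (hφ : φ ∈ IsManifold.maximalAtlas (𝓡 2) ∞ M) {z : E2}
    (hz : z ∈ φ.target) (i j : Fin 2) :
    secondForm x n (φ.symm z) (coordVec φ z i) (coordVec φ z j) =
      formCoeff (x ∘ φ.symm) (n ∘ φ.symm) i j z := by
  simp only [secondForm, coordVec, formCoeff, stdVec, diff_mfderiv_chart_symm hx hφ hz,
    diff_mfderiv_chart_symm hn hφ hz]

lemma thirdForm_coordVec [IsManifold (𝓡 2) ∞ M] {n : M → E3}
    (hn : ContMDiff (𝓡 2) 𝓘(ℝ, E3) ∞ n)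
    {φ : OpenPartialHomeomorph M E2} (hφ : φ ∈ IsManifold.maximalAtlas (𝓡 2) ∞ M) {z : E2}
    (hz : z ∈ φ.target) (i j : Fin 2) :
    thirdForm n (φ.symm z) (coordVec φ z i) (coordVec φ z j) =
      inner ℝ (fderiv ℝ (n ∘ φ.symm) z (stdVec i)) (fderiv ℝ (n ∘ φ.symm) z (stdVec j)) := by
  simp only [thirdForm, coordVec, stdVec, diff_mfderiv_chart_symm hn hφ hz]

/-- Integrating the square root of the Hopf differential gives a Hopf chart. -/
lemma exists_isHopfChart [IsManifold (𝓡 2) ∞ M] {xhat x n : M → E3}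
    (hmin : IsMinimalSurface xhat n) (humb : ∀ p : M, ¬ IsUmbilic xhat n p)
    (hcomb : IsCombescurePair n x xhat) (p : M) :
    ∃ φ : OpenPartialHomeomorph M E2, p ∈ φ.source ∧ IsHopfChart xhat n φ := by
  have hx := hmin.surface.smooth
  have hn := hmin.surface.smooth_normal
  have hnorm := hmin.surface.norm_normal
  obtain ⟨φ, hφ, hp, hconf⟩ := exists_conformal_chart hn hnorm
    (fun p X => diff_normal_injective hmin humb hcomb p) p
  set Y := xhat ∘ φ.symm with hYdef
  set N := n ∘ φ.symm with hNdef
  have hY : ∀ z ∈ φ.target, ContDiffAt ℝ ∞ Y z := fun z hz => contDiffAt_comp_chart_symm hx hφ hz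
  have hN : ∀ z ∈ φ.target, ContDiffAt ℝ ∞ N z := fun z hz => contDiffAt_comp_chart_symm hn hφ hz
  have hYN : ∀ z ∈ φ.target, ∀ v, inner ℝ (fderiv ℝ Y z v) (N z) = 0 := fun z hz v =>
    hmin.surface.inner_chart_eq_zero hφ hz v
  have hsymm : ∀ z ∈ φ.target, formCoeff Y N 1 0 z = formCoeff Y N 0 1 z := by
    intro z hz
    rw [formCoeff, formCoeff, inner_fderiv_symm (hY z hz) (hN z hz)]
    filter_upwards [φ.open_target.mem_nhds hz] with u hu using hYN u hu
  have hframe : ∀ z ∈ φ.target, formCoeff Y N 0 0 z + formCoeff Y N 1 1 z = 0 ∧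
      (formCoeff Y N 0 0 z ≠ 0 ∨ formCoeff Y N 0 1 z ≠ 0) := by
    intro z hz
    obtain ⟨ρ, hρ, h⟩ := hconf z hz
    have hIII := thirdForm_coordVec hn hφ hz
    simp only [← hNdef, h, inner_stdVec] at hIII
    have := secondForm_conformal_frame hmin humb hcomb (φ.symm z) (X := coordVec φ z 0)
      (Y := coordVec φ z 1) (by rw [hIII]; simp) (by rw [hIII, hIII]; simp)
      (by rw [hIII]; simpa using hρ.ne')
    simpa only [secondForm_coordVec hx hn hφ hz] using this
  have hN0 : ∀ z ∈ φ.target, N z ≠ 0 := fun z _ h => by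
    have h1 := hnorm (φ.symm z)
    rw [show n (φ.symm z) = 0 from h, norm_zero] at h1
    exact zero_ne_one h1
  have hcod := fun z (hz : z ∈ φ.target) => codazzi_conformal φ.open_target hY hN hYN
    (fun z hz v => inner_fderiv_normal_eq_zero hn hnorm hφ hz v) hN0 hconf
    (fun z hz => (hframe z hz).1) hz
  set e : ℂ ≃ₗᵢ[ℝ] E2 := Complex.orthonormalBasisOneI.repr with he
  set H : ℂ → ℂ := fun w => (1 / 2 : ℂ) *
      ((formCoeff Y N 0 0 (e w) : ℂ) - Complex.I * (formCoeff Y N 0 1 (e w) : ℂ)) with hHdef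
  have hHd : ∀ w ∈ e ⁻¹' φ.target, DifferentiableAt ℂ H w := fun w hw =>
    hopf_differentiableAt (hY _ hw) (hN _ hw) (hcod _ hw).1 (hcod _ hw).2
  have hp' : e.symm (φ p) ∈ e ⁻¹' φ.target := by simpa using φ.map_source hp
  have hH0 : H (e.symm (φ p)) ≠ 0 := by
    intro h0
    have hre := congrArg Complex.re h0
    have him := congrArg Complex.im h0
    simp [hHdef] at hre him
    rcases (hframe _ (φ.map_source hp)).2 with h | h
    · exact h hre
    · exact h him
  obtain ⟨W, G, g, hW, hpW, hWV, hG⟩ :=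
    exists_primitive_sqrt (φ.open_target.preimage e.continuous) hHd hp' hH0
  have hfd : ∀ z ∈ e.symm ⁻¹' W, ∀ v, fderiv ℝ (e ∘ G ∘ e.symm) z v =
      e (g (e.symm z) * e.symm v) := by
    intro z hz v
    have h1 := ((hG _ hz).2.1.hasFDerivAt.restrictScalars ℝ).comp z
      (e.symm.toContinuousLinearEquiv : E2 →L[ℝ] ℂ).hasFDerivAt
    have h2 := (e.toContinuousLinearEquiv : ℂ →L[ℝ] E2).hasFDerivAt.comp z h1
    have h3 := congrArg (fun L : E2 →L[ℝ] E2 => L v) h2.fderiv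
    refine Eq.trans h3 ?_
    simp [mul_comm]
  obtain ⟨φ', hφ', hps', h⟩ := exists_chart_comp hφ hp (U := e.symm ⁻¹' W) (f := e ∘ G ∘ e.symm)
    (hW.preimage e.symm.continuous) hpW
    (fun z hz => e.toContinuousLinearEquiv.contDiff.contDiffAt.comp z
      ((hG _ hz).1.comp z e.symm.toContinuousLinearEquiv.contDiff.contDiffAt))
    (by
      intro z hz
      rw [injective_iff_map_eq_zero]
      intro v hv
      rw [hfd z hz] at hv
      simpa [(hG _ hz).2.2.1] using hv)
  have e1 : e 1 = stdVec 0 := by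
    ext i; fin_cases i <;> simp [he, stdVec]
  have eI : e Complex.I = stdVec 1 := by
    ext i; fin_cases i <;> simp [he, stdVec]
  have hvec : ∀ z' ∈ φ'.target, ∃ z ∈ φ.target, ∃ c : ℂ, c ≠ 0 ∧ c ^ 2 * H (e.symm z) = 1 ∧
      ∀ y : M → E3, ContMDiff (𝓡 2) 𝓘(ℝ, E3) ∞ y →
        fderiv ℝ (y ∘ φ'.symm) z' (stdVec 0) = c.re • fderiv ℝ (y ∘ φ.symm) z (stdVec 0) +
          c.im • fderiv ℝ (y ∘ φ.symm) z (stdVec 1) ∧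
        fderiv ℝ (y ∘ φ'.symm) z' (stdVec 1) = -c.im • fderiv ℝ (y ∘ φ.symm) z (stdVec 0) +
          c.re • fderiv ℝ (y ∘ φ.symm) z (stdVec 1) := by
    intro z' hz'
    obtain ⟨z, hz, -, hy⟩ := h z' hz'
    have hg0 := (hG _ hz).2.2.1
    have hzt : z ∈ φ.target := by simpa using hWV hz
    refine ⟨z, hzt, (g (e.symm z))⁻¹, inv_ne_zero hg0, ?_, fun y hys => ?_⟩
    · rw [← (hG _ hz).2.2.2, ← mul_pow, inv_mul_cancel₀ hg0, one_pow]
    set c := (g (e.symm z))⁻¹ with hc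
    have hec : ∀ w : ℂ, e w = w.re • stdVec 0 + w.im • stdVec 1 := by
      intro w
      rw [← e1, ← eI, ← map_smul, ← map_smul, ← map_add]
      congr 1
      simp [Complex.re_add_im]
    have key : ∀ w : ℂ, fderiv ℝ (y ∘ φ'.symm) z' (e w) = fderiv ℝ (y ∘ φ.symm) z (e (c * w)) := by
      intro w
      rw [← hy y hys, hfd z hz, e.symm_apply_apply, hc, mul_inv_cancel_left₀ hg0]
    refine ⟨?_, ?_⟩
    · rw [← e1, key, mul_one, hec, map_add, map_smul, map_smul, e1]
    · rw [← eI, key, hec, map_add, map_smul, map_smul, eI]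
      simp
  have hforms : ∀ z' ∈ φ'.target, formCoeff (xhat ∘ φ'.symm) (n ∘ φ'.symm) 0 0 z' = 2 ∧
      formCoeff (xhat ∘ φ'.symm) (n ∘ φ'.symm) 1 1 z' = -2 ∧
      formCoeff (xhat ∘ φ'.symm) (n ∘ φ'.symm) 0 1 z' = 0 := by
    intro z' hz'
    obtain ⟨z, hz, c, -, hcH, hy⟩ := hvec z' hz'
    have hre := congrArg Complex.re hcH
    have him := congrArg Complex.im hcH
    simp [hHdef, pow_two] at hre him
    have ht := (hframe z hz).1
    have hs := hsymm z hz
    have hbil : ∀ a b a' b' : ℝ, -inner ℝ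
        (a • fderiv ℝ Y z (stdVec 0) + b • fderiv ℝ Y z (stdVec 1))
        (a' • fderiv ℝ N z (stdVec 0) + b' • fderiv ℝ N z (stdVec 1)) =
        a * a' * formCoeff Y N 0 0 z + a * b' * formCoeff Y N 0 1 z +
          b * a' * formCoeff Y N 1 0 z + b * b' * formCoeff Y N 1 1 z := by
      intro a b a' b'
      simp only [inner_add_left, inner_add_right, real_inner_smul_left, real_inner_smul_right,
        formCoeff]
      ring
    rw [formCoeff, formCoeff, formCoeff, (hy xhat hx).1, (hy xhat hx).2, (hy n hn).1, (hy n hn).2,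
      hbil, hbil, hbil, hs]
    have ht' : formCoeff Y N 1 1 z = -formCoeff Y N 0 0 z := by linarith
    rw [ht']
    refine ⟨?_, ?_, ?_⟩
    · linear_combination 2 * hre
    · linear_combination -2 * hre
    · linear_combination -2 * him
  refine ⟨φ', hps', hφ', fun z' hz' => ?_, fun z' hz' => ?_, fun z' hz' => ?_, fun z' hz' => ?_⟩
  · obtain ⟨z, hz, c, hc, -, hy⟩ := hvec z' hz'
    obtain ⟨ρ, hρ, hρz⟩ := hconf z hz
    refine ⟨ρ * Complex.normSq c, mul_pos hρ (Complex.normSq_pos.2 hc), fun i j => ?_⟩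
    rw [thirdForm_coordVec hn hφ' hz']
    have hnn : ∀ i j, inner ℝ (fderiv ℝ N z (stdVec i)) (fderiv ℝ N z (stdVec j)) =
        if i = j then ρ else 0 := by
      intro i j
      rw [hρz, inner_stdVec]
      simp
    fin_cases i <;> fin_cases j <;>
    simp only [Fin.zero_eta, Fin.mk_one, Fin.isValue, (hy n hn).1, (hy n hn).2, ← hNdef,
      inner_add_left, inner_add_right, real_inner_smul_left, real_inner_smul_right, hnn,
      Complex.normSq_apply] <;>
    norm_num <;> ring
  · rw [secondForm_coordVec hx hn hφ' hz', (hforms z' hz').1]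
  · rw [secondForm_coordVec hx hn hφ' hz', (hforms z' hz').2.1]
  · rw [secondForm_coordVec hx hn hφ' hz', (hforms z' hz').2.2]

end

section

variable {M : Type*} [TopologicalSpace M] [ChartedSpace E2 M]

/-- The second fundamental form as a bilinear form. -/
noncomputable def secondFormBilin (x n : M → E3) (p : M) :
    TangentSpace (𝓡 2) p →ₗ[ℝ] TangentSpace (𝓡 2) p →ₗ[ℝ] ℝ :=
  LinearMap.mk₂ ℝ (secondForm x n p)
    (fun X X' Y => by simp only [secondForm, map_add, inner_add_left]; ring)
    (fun c X Y => by simp only [secondForm, map_smul, real_inner_smul_left, smul_eq_mul]; ring)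
    (fun X Y Y' => by simp only [secondForm, map_add, inner_add_right]; ring)
    (fun c X Y => by simp only [secondForm, map_smul, real_inner_smul_right, smul_eq_mul]; ring)

lemma secondFormBilin_apply (x n : M → E3) (p : M) (X Y : TangentSpace (𝓡 2) p) :
    secondFormBilin x n p X Y = secondForm x n p X Y := rfl

lemma IsHopfChart.isConformalChart {xhat n : M → E3} {φ : OpenPartialHomeomorph M E2}
    (h : IsHopfChart xhat n φ) : IsConformalChart n φ := by
  refine ⟨h.mem_atlas, fun z => Real.log (thirdForm n (φ.symm z) (coordVec φ z 0)
    (coordVec φ z 0)) / 2, fun z hz i j => ?_⟩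
  obtain ⟨ρ, hρ, hz'⟩ := h.conformal z hz
  beta_reduce
  rw [hz', hz', if_pos rfl, mul_div_cancel₀ _ two_ne_zero, Real.exp_log hρ]

lemma secondForm_symm [IsManifold (𝓡 2) ∞ M] {x n : M → E3} (h : IsSurfaceWithNormal x n) (p : M)
    (X Y : TangentSpace (𝓡 2) p) : secondForm x n p X Y = secondForm x n p Y X := by
  rw [secondForm, secondForm, h.inner_diff_symm]

lemma IsHopfChart.coeff_eq [IsManifold (𝓡 2) ∞ M] {xhat n : M → E3}
    (hs : IsSurfaceWithNormal xhat n) {φ : OpenPartialHomeomorph M E2}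
    (h : IsHopfChart xhat n φ) {z : E2} (hz : z ∈ φ.target) :
    coeff20 φ z (secondForm xhat n (φ.symm z)) = 1 ∧
      coeff11 φ z (secondForm xhat n (φ.symm z)) = 0 := by
  rw [coeff20, coeff11, secondForm_symm hs _ (coordVec φ z 1) (coordVec φ z 0), h.form00 z hz,
    h.form11 z hz, h.form01 z hz]
  constructor <;> push_cast <;> ring

/-- If the off-diagonal coefficients of the second and third fundamental forms vanish in a chart,
its coordinate vectors are curvature directions. -/
lemma isCurvatureDirection_coordVec [IsManifold (𝓡 2) ∞ M] {x n : M → E3}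
    (h : IsSurfaceWithNormal x n) {φ : OpenPartialHomeomorph M E2}
    (hφ : φ ∈ IsManifold.maximalAtlas (𝓡 2) ∞ M) {z : E2} (hz : z ∈ φ.target) {ρ : ℝ}
    (hρ : 0 < ρ) (hconf : ∀ i j : Fin 2,
      thirdForm n (φ.symm z) (coordVec φ z i) (coordVec φ z j) = if i = j then ρ else 0)
    {i j : Fin 2} (hij : i ≠ j)
    (hII : secondForm x n (φ.symm z) (coordVec φ z i) (coordVec φ z j) = 0) :
    IsCurvatureDirection x n (φ.symm z) (coordVec φ z i) := by
  have hne : ∀ k, diff n (φ.symm z) (coordVec φ z k) ≠ 0 := by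
    intro k h0
    have := hconf k k
    rw [thirdForm, h0, inner_zero_left, if_pos rfl] at this
    exact hρ.ne this
  have hnn : ∀ k, inner ℝ (n (φ.symm z)) (diff n (φ.symm z) (coordVec φ z k)) = 0 := by
    intro k
    rw [real_inner_comm, coordVec, diff_mfderiv_chart_symm h.smooth_normal hφ hz]
    exact inner_fderiv_normal_eq_zero h.smooth_normal h.norm_normal hφ hz _
  have hn0 : n (φ.symm z) ≠ 0 := fun h0 => by
    have h1 := h.norm_normal (φ.symm z)
    rw [h0, norm_zero] at h1
    exact zero_ne_one h1
  have hii := hconf i i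
  have hji := hconf i j
  rw [thirdForm, if_pos rfl] at hii
  rw [thirdForm, if_neg hij] at hji
  rw [secondForm, neg_eq_zero] at hII
  refine ⟨fun h0 => hne i (by rw [h0, map_zero]), ρ,
    secondForm x n (φ.symm z) (coordVec φ z i) (coordVec φ z i), Or.inl hρ.ne', ?_⟩
  refine eq_zero_of_inner_eq_zero hn0 (hne i) (hne j) (hnn i) (hnn j) hji ?_ ?_ ?_
  · rw [inner_add_left, real_inner_smul_left, real_inner_smul_left, h.orthogonal,
      real_inner_comm, hnn, mul_zero, mul_zero, add_zero]
  · rw [inner_add_left, real_inner_smul_left, real_inner_smul_left, hii, secondForm]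
    ring
  · rw [inner_add_left, real_inner_smul_left, real_inner_smul_left, hji, hII]
    ring

end

end LIsothermic

theorem mainTheorem12 {M : Type*} [TopologicalSpace M] [ChartedSpace LIsothermic.E2 M]
    [IsManifold (𝓡 2) ∞ M] (xhat x n : M → LIsothermic.E3)
    (hmin : LIsothermic.IsMinimalSurface xhat n)
    (humb : ∀ p : M, ¬ LIsothermic.IsUmbilic xhat n p)
    (hcomb : LIsothermic.IsCombescurePair n x xhat) :
    LIsothermic.IsLIsothermic x n := by
  open LIsothermic in
  choose μ ν hμν using exists_secondForm_eq hmin humb hcomb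
  refine ⟨hcomb.left, fun p => ?_, secondFormBilin xhat n, ⟨fun p X Y => ?_, fun p => ?_⟩, μ,
    fun φ hφ z hz => ?_⟩
  · obtain ⟨φ, hp, hφ⟩ := exists_isHopfChart hmin humb hcomb p
    refine ⟨φ, hp, hφ.isConformalChart, fun z hz i => ?_⟩
    obtain ⟨ρ, hρ, hconf⟩ := hφ.conformal z hz
    have hII : secondForm x n (φ.symm z) (coordVec φ z 0) (coordVec φ z 1) = 0 := by
      rw [hμν, hφ.form01 z hz, hconf, if_neg (by simp), mul_zero, mul_zero, add_zero]
    have hdir := fun {i j : Fin 2} => isCurvatureDirection_coordVec hcomb.left hφ.mem_atlas hz hρ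
      hconf (i := i) (j := j)
    fin_cases i
    · exact hdir zero_ne_one hII
    · exact hdir one_ne_zero ((secondForm_symm hcomb.left _ _ _).trans hII)
  · exact secondForm_symm hmin.surface p X Y
  · obtain ⟨φ, hp, hφ⟩ := exists_isHopfChart hmin humb hcomb p
    exact ⟨φ, hp, hφ.isConformalChart, fun z hz => hφ.coeff_eq hmin.surface hz⟩
  · obtain ⟨-, w, hw⟩ := hφ
    simp only [coeff20, secondFormBilin_apply, hμν, hw z hz]
    push_cast
    simp
    ring
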